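/- Use the Fourier transform $\widehat f(\xi)=\int_{\mathbb R^d} f(x)e^{-i\xi\cdot x}\,dx$ on $\mathbb R^d$, and let $\Lambda^s=(-\Delta)^{s/2}$ be the Fourier multiplier with symbol $|\xi|^s$, i.e. $\widehat{\Lambda^s f}(\xi)=|\xi|^s\widehat f(\xi)$. Let $d\ge 1$ and $s>2$. There exists $p_0>2$, depending only on $(s,d)$, such that for every $p\in[p_0,\infty)$ both of the following hold. (i) There exist a constant $C_{p,d,s}>0$, depending only on $(p,d,s)$, and a function $f\in C_c^\infty(\mathbb R^d,\mathbb R)$ such that $$\int_{\mathbb R^d}(\Lambda^s f)\,|f|^{p-2}f\,dx\le -C_{p,d,s}<0.$$ (ii) There exist constants $D_1,D_2,\alpha_1,\alpha_2>0$, depending only on $(p,d,s)$, a sequence of positive numbers $N_j\to\infty$, and a sequence of Schwartz functions $f_j:\mathbb R^d\to\mathbb R$, such that for every $j$ $$\mathrm{supp}(\widehat{f_j})\subset\{\xi:\ \alpha_1N_j<|\xi|<\alpha_2N_j\}$$ (where $\mathrm{supp}$ is the closed support) and $$-D_2<\frac{\int_{\mathbb R^d}(\Lambda^s f_j)\,|f_j|^{p-2}f_j\,dx}{N_j^s\int_{\mathbb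 R^d}|f_j|^p\,dx}<-D_1<0.$$ -/

import Mathlib

open Filter MeasureTheory
open scoped FourierTransform ContDiff SchwartzMap RealInnerProductSpace

/-- The Fourier transform of a real-valued function on `ℝ^d` in the angular-frequency convention
`f̂(ξ) = ∫ f(x) e^{-i ξ·x} dx`. Mathlib's `𝓕` has the phase `e^{-2πi ξ·x}`, hence the
rescaling of the frequency; see `angularFourier_eq`. -/
noncomputable def angularFourier {d : ℕ} (f : EuclideanSpace ℝ (Fin d) → ℝ)
    (ξ : EuclideanSpace ℝ (Fin d)) : ℂ :=
  𝓕 (fun x => (f x : ℂ)) ((2 * Real.pi)⁻¹ • ξ)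

/-- The literal integral formula for `angularFourier`. -/
theorem angularFourier_eq {d : ℕ} (f : EuclideanSpace ℝ (Fin d) → ℝ)
    (ξ : EuclideanSpace ℝ (Fin d)) :
    angularFourier f ξ = ∫ x, (f x : ℂ) * Complex.exp (-(Complex.I * (⟪ξ, x⟫ : ℝ))) := by
  have hpi : (Real.pi : ℂ) ≠ 0 := by exact_mod_cast Real.pi_ne_zero
  rw [angularFourier, Real.fourier_eq']
  congr 1
  ext x
  rw [smul_eq_mul, mul_comm, real_inner_smul_right, real_inner_comm]
  congr 2
  push_cast
  field_simp

/-- The fractional Laplacian `Λ^s = (-Δ)^{s/2}` as a complex-valued function: the Fourier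
multiplier `|ξ|^s` in the angular-frequency convention, that is `|2πη|^s` on the side of
Mathlib's `𝓕`; see `fracLaplacianC_eq`. -/
noncomputable def fracLaplacianC {d : ℕ} (s : ℝ) (f : EuclideanSpace ℝ (Fin d) → ℝ) :
    EuclideanSpace ℝ (Fin d) → ℂ :=
  𝓕⁻ (fun η => ((‖(2 * Real.pi) • η‖ ^ s : ℝ) : ℂ) * 𝓕 (fun x => (f x : ℂ)) η)

/-- `Λ^s f` for a real-valued `f`. It is real-valued, so that taking the real part
discards nothing; see `ofReal_fracLaplacian`. -/
noncomputable def fracLaplacian {d : ℕ} (s : ℝ) (f : EuclideanSpace ℝ (Fin d) → ℝ)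
    (x : EuclideanSpace ℝ (Fin d)) : ℝ :=
  (fracLaplacianC s f x).re

/-- Fourier inversion formula `Λ^s f(x) = (2π)^{-d} ∫ |ξ|^s f̂(ξ) e^{i ξ·x} dξ`. -/
theorem fracLaplacianC_eq {d : ℕ} (s : ℝ) (f : EuclideanSpace ℝ (Fin d) → ℝ)
    (x : EuclideanSpace ℝ (Fin d)) :
    fracLaplacianC s f x = ((2 * Real.pi) ^ d : ℝ)⁻¹ • ∫ ξ : EuclideanSpace ℝ (Fin d),
      ((‖ξ‖ ^ s : ℝ) : ℂ) * angularFourier f ξ * Complex.exp (Complex.I * (⟪ξ, x⟫ : ℝ)) := by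
  have h2 : (0 : ℝ) < 2 * Real.pi := by positivity
  have key := Measure.integral_comp_smul (volume : Measure (EuclideanSpace ℝ (Fin d)))
    (fun ξ => ((‖ξ‖ ^ s : ℝ) : ℂ) * angularFourier f ξ *
      Complex.exp (Complex.I * (⟪ξ, x⟫ : ℝ))) (2 * Real.pi)
  rw [finrank_euclideanSpace_fin, abs_of_nonneg (by positivity)] at key
  rw [← key, fracLaplacianC, Real.fourierInv_eq']
  congr 1
  ext η
  rw [angularFourier, smul_smul, inv_mul_cancel₀ h2.ne', one_smul, smul_eq_mul, mul_comm,
    real_inner_smul_left]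
  congr 2
  push_cast
  ring

theorem ofReal_fracLaplacian {d : ℕ} (s : ℝ) (f : EuclideanSpace ℝ (Fin d) → ℝ)
    (x : EuclideanSpace ℝ (Fin d)) :
    ((fracLaplacian s f x : ℝ) : ℂ) = fracLaplacianC s f x := by
  have hconj : ∀ ξ, (starRingEnd ℂ) (angularFourier f ξ) = angularFourier f (-ξ) := by
    intro ξ
    rw [angularFourier_eq, angularFourier_eq, ← integral_conj]
    congr 1
    ext y
    rw [map_mul, ← Complex.exp_conj, inner_neg_left]
    simp
  rw [fracLaplacian]
  refine Complex.conj_eq_iff_re.mp ?_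
  rw [fracLaplacianC_eq, Complex.real_smul, map_mul, Complex.conj_ofReal, ← integral_conj,
    ← integral_neg_eq_self]
  congr 2
  ext ξ
  rw [map_mul, map_mul, ← Complex.exp_conj, hconj, neg_neg, norm_neg, inner_neg_left]
  simp

/-! As `p → ∞`, the weight `|f|^(p-2) f` concentrates at a strict global maximum of `|f|`. So if `f
0 = 1`, `|f| < 1` elsewhere and `Λ^s f (0) < 0`, the integral is negative for all large `p`
(`exists_forall_integral_mul_abs_rpow_mul_neg`). It remains to find such an `f`, which is possible
because `s > 2`.

The polynomial `(9 cos t - cos 3t) / 8` attains its maximum `1` at `t = 0`, where the multiplier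
`|ξ|^s` gives `(9 - 3^s) / 8`. This vanishes for `s = 2` and is negative for `s > 2`. Multiplying by
an envelope `ψ` with a strict maximum at the origin supplies decay and a strict maximum. At high
carrier frequency `R` the envelope is negligible: `R^(-s) Λ^s f (0)` tends to `(2π)^s (9 - 3^s) / 8`
(`tendsto_fracLaplacian_wavePacket_zero`).

A compactly supported envelope gives (i). A band-limited envelope gives a packet with spectrum in an
annulus, and its dilates give (ii), since the quotient normalised by `N^s` is dilation invariant
(`bernsteinQuotient_comp_smul`). Both packets are fixed before `p`, so `p₀` depends only on `s` and
`d`. -/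

section Concentration

/-! ### Concentration of `|F|^(p-2) F` at a strict maximum. -/

variable {X : Type*} [NormedAddCommGroup X]

/-- A continuous function that decays at infinity and stays strictly below `1` in absolute value
away from the origin is bounded away from `1` outside every ball around the origin. -/
theorem exists_lt_one_abs_le_of_notMem_ball {F : X → ℝ} (hF : Continuous F)
    (hF1 : ∀ x, x ≠ 0 → |F x| < 1) (hF2 : Tendsto F (cocompact X) (nhds 0)) {r : ℝ} (hr : 0 < r) :
    ∃ θ : ℝ, 0 < θ ∧ θ < 1 ∧ ∀ x ∉ Metric.ball (0 : X) r, |F x| ≤ θ := by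
  have hev : ∀ᶠ x in cocompact X, |F x| < 1 / 2 := by
    have h := hF2.abs
    rw [abs_zero] at h
    exact h.eventually_lt_const (by norm_num)
  obtain ⟨K, hK, hKs⟩ := mem_cocompact.mp hev
  have hK' : IsCompact (K \ Metric.ball (0 : X) r) := hK.diff Metric.isOpen_ball
  rcases (K \ Metric.ball (0 : X) r).eq_empty_or_nonempty with h0 | hne
  · refine ⟨1 / 2, by norm_num, by norm_num, fun x hx => ?_⟩
    have hxK : x ∉ K := fun h => by
      have : x ∈ K \ Metric.ball (0 : X) r := ⟨h, hx⟩
      rw [h0] at this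
      exact this
    exact (hKs hxK).le
  · obtain ⟨y, hy, hmax⟩ := hK'.exists_isMaxOn hne hF.abs.continuousOn
    have hy0 : y ≠ 0 := by
      rintro rfl
      exact hy.2 (Metric.mem_ball_self hr)
    refine ⟨max (1 / 2) |F y|, by positivity, max_lt (by norm_num) (hF1 y hy0), fun x hx => ?_⟩
    by_cases hxK : x ∈ K
    · exact le_max_of_le_right (hmax ⟨hxK, hx⟩)
    · exact le_max_of_le_left (hKs hxK).le

variable [MeasurableSpace X] [BorelSpace X] (μ : Measure X)

theorem integrable_mul_abs_rpow_mul {F G : X → ℝ} {B p : ℝ} (hp : 2 < p)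
    (hG : Continuous G) (hGB : ∀ x, |G x| ≤ B)
    (hF : Continuous F) (hFi : Integrable F μ) (hF1 : ∀ x, |F x| ≤ 1) :
    Integrable (fun x => G x * (|F x| ^ (p - 2) * F x)) μ := by
  refine (hFi.norm.const_mul B).mono' ?_ (ae_of_all _ fun x => ?_)
  · exact (hG.mul ((hF.abs.rpow_const fun x => Or.inr (by linarith)).mul hF)).aestronglyMeasurable
  · have hB : 0 ≤ B := (abs_nonneg _).trans (hGB x)
    have h1 : |F x| ^ (p - 2) ≤ 1 := Real.rpow_le_one (abs_nonneg _) (hF1 x) (by linarith)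
    rw [Real.norm_eq_abs, Real.norm_eq_abs, abs_mul, abs_mul,
      abs_of_nonneg (Real.rpow_nonneg (abs_nonneg _) _)]
    gcongr
    · exact hGB x
    · exact mul_le_of_le_one_left (abs_nonneg _) h1

/-- Laplace's principle: as `p → ∞` the weight `|F|^{p-2} F` concentrates at the strict maximum
of `|F|`, so that its integral against `G` takes the sign of `G` there. -/
theorem exists_forall_integral_mul_abs_rpow_mul_neg [ProperSpace X] [μ.IsOpenPosMeasure]
    [IsFiniteMeasureOnCompacts μ] {F G : X → ℝ} {B : ℝ}
    (hG : Continuous G) (hGB : ∀ x, |G x| ≤ B) (hG0 : G 0 < 0)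
    (hF : Continuous F) (hFi : Integrable F μ) (hF0 : F 0 = 1)
    (hF1 : ∀ x, x ≠ 0 → |F x| < 1) (hF2 : Tendsto F (cocompact X) (nhds 0)) :
    ∃ p₀ : ℝ, 2 < p₀ ∧ ∀ p, p₀ ≤ p → ∫ x, G x * (|F x| ^ (p - 2) * F x) ∂μ < 0 := by
  have hFle : ∀ x, |F x| ≤ 1 := fun x => by
    by_cases hx : x = 0
    · simp [hx, hF0]
    · exact (hF1 x hx).le
  have hB : 0 ≤ B := (abs_nonneg _).trans (hGB 0)
  set c : ℝ := -G 0 / 2 with hc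
  have hc0 : 0 < c := by linarith
  have hnear : ∀ᶠ x in nhds (0 : X), G x < -c ∧ 0 < F x :=
    (hG.continuousAt.eventually_lt_const (by linarith)).and
      (hF.continuousAt.eventually_const_lt (by linarith))
  obtain ⟨r, hr, hball⟩ := Metric.eventually_nhds_iff_ball.mp hnear
  obtain ⟨θ, hθ0, hθ1, hθ⟩ := exists_lt_one_abs_le_of_notMem_ball hF hF1 hF2 hr
  -- Two levels `θ < κ < 1`: `|F| ≤ θ` away from the origin and `F > κ` close to it, so the far part
  -- is smaller than the near part by a factor of order `(θ / κ)^(p-2)`.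
  obtain ⟨κ, hθκ, hκ1⟩ := exists_between hθ1
  have hκ0 : 0 < κ := hθ0.trans hθκ
  have hnear' : ∀ᶠ x in nhds (0 : X), κ < F x :=
    hF.continuousAt.eventually_const_lt (by linarith)
  obtain ⟨r', hr', hball'⟩ := Metric.eventually_nhds_iff_ball.mp hnear'
  set ρ := min r r' with hρ
  have hρ0 : 0 < ρ := lt_min hr hr'
  set V : ℝ := μ.real (Metric.ball (0 : X) ρ) with hV
  have hVfin : μ (Metric.ball (0 : X) ρ) ≠ ⊤ := measure_ball_lt_top.ne
  have hV0 : 0 < V := ENNReal.toReal_pos (Metric.measure_ball_pos μ 0 hρ0).ne' hVfin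
  set A : ℝ := ∫ x, |F x| ∂μ with hA
  have hlim : Tendsto (fun t : ℝ => B * (θ / κ) ^ t * A) atTop (nhds (B * 0 * A)) :=
    ((tendsto_rpow_atTop_of_base_lt_one _ (by linarith [div_pos hθ0 hκ0])
      ((div_lt_one hκ0).2 hθκ)).const_mul B).mul_const A
  have hev : ∀ᶠ t : ℝ in atTop, B * (θ / κ) ^ t * A < c * κ * V :=
    hlim.eventually_lt_const (by rw [mul_zero, zero_mul]; positivity)
  obtain ⟨T, hT⟩ := eventually_atTop.mp hev
  refine ⟨max 3 (T + 2), by simp; left; norm_num, fun p hp => ?_⟩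
  have hp3 : 3 ≤ p := (le_max_left _ _).trans hp
  have hpT : T ≤ p - 2 := by linarith [(le_max_right 3 (T + 2)).trans hp]
  have hbound : ∀ x, G x * (|F x| ^ (p - 2) * F x) ≤
      (Metric.ball (0 : X) ρ).indicator (fun _ => -(c * κ * κ ^ (p - 2))) x +
        B * θ ^ (p - 2) * |F x| := by
    intro x
    have hpow : 0 ≤ |F x| ^ (p - 2) := Real.rpow_nonneg (abs_nonneg _) _
    have hrest : 0 ≤ B * θ ^ (p - 2) * |F x| := by positivity
    by_cases hx : x ∈ Metric.ball (0 : X) r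
    · obtain ⟨h1, h2⟩ := hball x hx
      by_cases hx' : x ∈ Metric.ball (0 : X) ρ
      · rw [Set.indicator_of_mem hx']
        have h3 : κ < F x := hball' x (Metric.ball_subset_ball (min_le_right _ _) hx')
        have h4 : κ ^ (p - 2) * κ ≤ |F x| ^ (p - 2) * F x := by
          rw [abs_of_pos h2]
          gcongr
          linarith
        have h5 : c * (κ ^ (p - 2) * κ) ≤ -G x * (|F x| ^ (p - 2) * F x) :=
          mul_le_mul (by linarith) h4 (by positivity) (by linarith)
        linarith
      -- In the intermediate shell `G < 0 < F`, so the contribution has the favourable sign and can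
      -- be dropped.
      · rw [Set.indicator_of_notMem hx', zero_add]
        exact (mul_nonpos_of_nonpos_of_nonneg (by linarith) (by positivity)).trans hrest
    · have hx' : x ∉ Metric.ball (0 : X) ρ :=
        fun h => hx (Metric.ball_subset_ball (min_le_left _ _) h)
      rw [Set.indicator_of_notMem hx', zero_add]
      refine (le_abs_self _).trans ?_
      rw [abs_mul, abs_mul, abs_of_nonneg hpow, ← mul_assoc]
      have h6 : |F x| ^ (p - 2) ≤ θ ^ (p - 2) :=
        Real.rpow_le_rpow (abs_nonneg _) (hθ x hx) (by linarith)
      gcongr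
      exact hGB x
  have hind : Integrable ((Metric.ball (0 : X) ρ).indicator
      (fun _ => -(c * κ * κ ^ (p - 2)))) μ :=
    (integrableOn_const hVfin).integrable_indicator Metric.isOpen_ball.measurableSet
  have hFa : Integrable (fun x => B * θ ^ (p - 2) * |F x|) μ := hFi.abs.const_mul _
  have hint := integrable_mul_abs_rpow_mul μ (by linarith : 2 < p) hG hGB hF hFi hFle
  have hmono := integral_mono hint (hind.add hFa) hbound
  refine hmono.trans_lt ?_
  simp only [Pi.add_apply]
  rw [integral_add hind hFa, integral_indicator Metric.isOpen_ball.measurableSet,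
    setIntegral_const, integral_const_mul, smul_eq_mul, ← hA, ← hV]
  have hfin := hT (p - 2) hpT
  rw [Real.div_rpow hθ0.le hκ0.le] at hfin
  have hk : 0 < κ ^ (p - 2) := Real.rpow_pos_of_pos hκ0 _
  have := mul_lt_mul_of_pos_right hfin hk
  have e : B * (θ ^ (p - 2) / κ ^ (p - 2)) * A * κ ^ (p - 2) = B * θ ^ (p - 2) * A := by
    field_simp
  rw [e] at this
  linarith

end Concentration

/-! ### The flat trigonometric polynomial. -/

/-- The gaps to `1` and `-1` factor as `(c - 1)^2 (c + 2) / 2` and `(c + 1)^2 (2 - c) / 2`. By the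
triple-angle formula this cubic in `c = cos t` is `flatCos t`. -/
theorem abs_three_mul_sub_cube_div_two_le_one {c : ℝ} (hc : |c| ≤ 1) :
    |(3 * c - c ^ 3) / 2| ≤ 1 := by
  obtain ⟨h1, h2⟩ := abs_le.mp hc
  rw [abs_le]
  constructor <;> nlinarith [sq_nonneg (c - 1), sq_nonneg (c + 1)]

/-- The even trigonometric polynomial `(9 cos t - cos 3t) / 8`. Its second derivative vanishes at
its maximum `t = 0`, so that the multiplier `|ξ|^s` with `s > 2` makes it negative there. -/
noncomputable def flatCos (t : ℝ) : ℝ :=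
  9 / 8 * Real.cos t - 1 / 8 * Real.cos (3 * t)

theorem flatCos_zero : flatCos 0 = 1 := by
  simp [flatCos]
  norm_num

theorem abs_flatCos_le_one (t : ℝ) : |flatCos t| ≤ 1 := by
  have h : flatCos t = (3 * Real.cos t - Real.cos t ^ 3) / 2 := by
    rw [flatCos, Real.cos_three_mul]
    ring
  rw [h]
  exact abs_three_mul_sub_cube_div_two_le_one (Real.abs_cos_le_one t)

@[fun_prop]
theorem hasTemperateGrowth_cos : Function.HasTemperateGrowth Real.cos := by
  refine ⟨Real.contDiff_cos, fun n => ⟨0, 1, fun x => ?_⟩⟩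
  rw [norm_iteratedFDeriv_eq_norm_iteratedDeriv, pow_zero, mul_one]
  exact Real.abs_iteratedDeriv_cos_le_one n x

@[fun_prop]
theorem hasTemperateGrowth_flatCos : Function.HasTemperateGrowth flatCos := by
  have h3 : Function.HasTemperateGrowth (fun t : ℝ => Real.cos (3 * t)) :=
    hasTemperateGrowth_cos.comp (((Function.HasTemperateGrowth.const (3 : ℝ))).mul
      Function.HasTemperateGrowth.id')
  exact ((Function.HasTemperateGrowth.const (9 / 8 : ℝ)).mul hasTemperateGrowth_cos).sub
    ((Function.HasTemperateGrowth.const (1 / 8 : ℝ)).mul h3)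

variable {d : ℕ}

/-! ### Regularity of `Λ^s` on Schwartz functions. -/

/-- The complexification of a real Schwartz function. -/
noncomputable def schwartzOfReal (f : 𝓢(EuclideanSpace ℝ (Fin d), ℝ)) :
    𝓢(EuclideanSpace ℝ (Fin d), ℂ) :=
  f.postcompCLM Complex.ofRealCLM

/-- The weight `(1 + ‖η‖)^s` also serves as the dominating function in the high-frequency limit. -/
theorem integrable_norm_rpow_mul {s : ℝ} (hs : 0 ≤ s) (g : 𝓢(EuclideanSpace ℝ (Fin d), ℂ)) :
    Integrable (fun η : EuclideanSpace ℝ (Fin d) => (((1 + ‖η‖) ^ s : ℝ) : ℂ) * g η) := by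
  obtain ⟨n, hn⟩ := exists_nat_ge s
  have hdom : Integrable (fun η : EuclideanSpace ℝ (Fin d) =>
      2 ^ (n - 1) * (‖g η‖ + ‖η‖ ^ n * ‖g η‖)) :=
    (g.integrable.norm.add (g.integrable_pow_mul volume n)).const_mul _
  refine hdom.mono' ?_ (ae_of_all _ fun η => ?_)
  · refine Continuous.aestronglyMeasurable ?_
    refine (Complex.continuous_ofReal.comp ?_).mul g.continuous
    exact (by fun_prop : Continuous fun η : EuclideanSpace ℝ (Fin d) => 1 + ‖η‖).rpow_const
      fun x => Or.inr hs
  · rw [norm_mul, Complex.norm_real, Real.norm_of_nonneg (by positivity)]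
    have h1 : (1 + ‖η‖) ^ s ≤ (1 + ‖η‖) ^ n := by
      rw [← Real.rpow_natCast]
      exact Real.rpow_le_rpow_of_exponent_le (by linarith [norm_nonneg η]) hn
    have h2 : (1 + ‖η‖) ^ n ≤ 2 ^ (n - 1) * (1 ^ n + ‖η‖ ^ n) :=
      add_pow_le zero_le_one (norm_nonneg η) n
    rw [one_pow] at h2
    calc (1 + ‖η‖) ^ s * ‖g η‖ ≤ 2 ^ (n - 1) * (1 + ‖η‖ ^ n) * ‖g η‖ := by
          gcongr
          exact h1.trans h2
      _ = _ := by ring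

theorem integrable_multiplier_mul {s : ℝ} (hs : 0 ≤ s) (g : 𝓢(EuclideanSpace ℝ (Fin d), ℂ)) :
    Integrable (fun η : EuclideanSpace ℝ (Fin d) =>
      ((‖(2 * Real.pi) • η‖ ^ s : ℝ) : ℂ) * g η) := by
  have h := (integrable_norm_rpow_mul hs g).norm.const_mul ((2 * Real.pi) ^ s)
  refine h.mono' ?_ (ae_of_all _ fun η => ?_)
  · refine Continuous.aestronglyMeasurable ?_
    refine (Complex.continuous_ofReal.comp ?_).mul g.continuous
    exact (by fun_prop : Continuous fun η : EuclideanSpace ℝ (Fin d) =>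
      ‖(2 * Real.pi) • η‖).rpow_const fun x => Or.inr hs
  · rw [norm_mul, norm_mul, Complex.norm_real, Complex.norm_real,
      Real.norm_of_nonneg (by positivity), Real.norm_of_nonneg (by positivity), norm_smul,
      Real.norm_of_nonneg (by positivity), Real.mul_rpow (by positivity) (by positivity), ← mul_assoc]
    gcongr
    linarith

theorem continuous_fracLaplacian {s : ℝ} (hs : 0 ≤ s) (f : 𝓢(EuclideanSpace ℝ (Fin d), ℝ)) :
    Continuous (fracLaplacian s f) := by
  have h : Continuous (fracLaplacianC s f) :=
    VectorFourier.fourierIntegral_continuous Real.continuous_fourierChar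
      (by simp only [LinearMap.neg_apply, innerₗ_apply_apply]; fun_prop)
      (integrable_multiplier_mul hs (𝓕 (schwartzOfReal f)))
  exact Complex.continuous_re.comp h

theorem abs_fracLaplacian_le (s : ℝ) (f : EuclideanSpace ℝ (Fin d) → ℝ)
    (x : EuclideanSpace ℝ (Fin d)) :
    |fracLaplacian s f x| ≤ ∫ η : EuclideanSpace ℝ (Fin d),
      ‖((‖(2 * Real.pi) • η‖ ^ s : ℝ) : ℂ) * 𝓕 (fun x => (f x : ℂ)) η‖ :=
  (Complex.abs_re_le_norm _).trans
    (VectorFourier.norm_fourierIntegral_le_integral_norm _ _ _ _ _)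

theorem fracLaplacianC_zero (s : ℝ) (f : EuclideanSpace ℝ (Fin d) → ℝ) :
    fracLaplacianC s f 0 = ∫ η : EuclideanSpace ℝ (Fin d),
      ((‖(2 * Real.pi) • η‖ ^ s : ℝ) : ℂ) * 𝓕 (fun x => (f x : ℂ)) η := by
  rw [fracLaplacianC, Real.fourierInv_eq']
  simp

/-! ### Scaling. -/

/-- Dilation of a function rescales its Fourier transform. -/
theorem fourier_comp_smul (f : EuclideanSpace ℝ (Fin d) → ℂ) {R : ℝ} (hR : 0 < R)
    (η : EuclideanSpace ℝ (Fin d)) :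
    𝓕 (fun x => f (R • x)) η = (((R ^ d)⁻¹ : ℝ) : ℂ) * 𝓕 f (R⁻¹ • η) := by
  have key := Measure.integral_comp_smul (volume : Measure (EuclideanSpace ℝ (Fin d)))
    (fun x => Complex.exp (((-2 * Real.pi * ⟪x, R⁻¹ • η⟫ : ℝ) : ℂ) * Complex.I) • f x) R
  rw [finrank_euclideanSpace_fin, abs_of_nonneg (by positivity)] at key
  rw [Real.fourier_eq', Real.fourier_eq', ← Complex.real_smul, ← key]
  congr 1
  ext x
  rw [real_inner_smul_left, real_inner_smul_right, mul_inv_cancel_left₀ hR.ne']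

theorem fracLaplacianC_comp_smul (s : ℝ) (f : EuclideanSpace ℝ (Fin d) → ℝ) {R : ℝ} (hR : 0 < R)
    (x : EuclideanSpace ℝ (Fin d)) :
    fracLaplacianC s (fun y => f (R • y)) x = ((R ^ s : ℝ) : ℂ) * fracLaplacianC s f (R • x) := by
  have key := Measure.integral_comp_smul (volume : Measure (EuclideanSpace ℝ (Fin d)))
    (fun η => Complex.exp (((2 * Real.pi * ⟪η, R • x⟫ : ℝ) : ℂ) * Complex.I) •
      (((‖(2 * Real.pi) • η‖ ^ s : ℝ) : ℂ) * 𝓕 (fun x => (f x : ℂ)) η)) R⁻¹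
  rw [finrank_euclideanSpace_fin, abs_of_nonneg (by positivity), inv_pow, inv_inv] at key
  rw [fracLaplacianC, fracLaplacianC, Real.fourierInv_eq', Real.fourierInv_eq',
    ← Complex.real_smul]
  -- Splits off the Jacobian `R^d`, which cancels against the `R^(-d)` in the Fourier transform of
  -- the dilated function.
  have key' : ∀ z : ℂ, R ^ s • z = (R ^ s * (R ^ d)⁻¹) • (R ^ d • z) := fun z => by
    rw [smul_smul, inv_mul_cancel_right₀ (by positivity)]
  rw [key', ← key, ← integral_smul]
  congr 1
  ext η
  rw [fourier_comp_smul (fun y => (f y : ℂ)) hR, real_inner_smul_left, real_inner_smul_right,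
    inv_mul_cancel_left₀ hR.ne', smul_comm (2 * Real.pi) R⁻¹, norm_smul R⁻¹, norm_inv,
    Real.norm_of_nonneg hR.le, Real.mul_rpow (by positivity) (by positivity),
    Real.inv_rpow hR.le]
  have : R ^ s ≠ 0 := (Real.rpow_pos_of_pos hR s).ne'
  simp only [smul_eq_mul, Complex.real_smul]
  push_cast
  have : ((R ^ s : ℝ) : ℂ) ≠ 0 := by exact_mod_cast this
  field_simp

theorem fracLaplacian_comp_smul (s : ℝ) (f : EuclideanSpace ℝ (Fin d) → ℝ) {R : ℝ} (hR : 0 < R)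
    (x : EuclideanSpace ℝ (Fin d)) :
    fracLaplacian s (fun y => f (R • y)) x = R ^ s * fracLaplacian s f (R • x) := by
  rw [fracLaplacian, fracLaplacianC_comp_smul s f hR, Complex.re_ofReal_mul, fracLaplacian]

/-- The quotient in the Bernstein inequality is invariant under dilation. -/
theorem bernsteinQuotient_comp_smul (s p : ℝ) (f : EuclideanSpace ℝ (Fin d) → ℝ) {R : ℝ}
    (hR : 0 < R) :
    (∫ x, fracLaplacian s (fun y => f (R • y)) x * (|f (R • x)| ^ (p - 2) * f (R • x))) /
        (R ^ s * ∫ x, |f (R • x)| ^ p) =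
      (∫ x, fracLaplacian s f x * (|f x| ^ (p - 2) * f x)) / ∫ x, |f x| ^ p := by
  have k1 := Measure.integral_comp_smul (volume : Measure (EuclideanSpace ℝ (Fin d)))
    (fun x => fracLaplacian s f x * (|f x| ^ (p - 2) * f x)) R
  have k2 := Measure.integral_comp_smul (volume : Measure (EuclideanSpace ℝ (Fin d)))
    (fun x => |f x| ^ p) R
  simp only [fracLaplacian_comp_smul s f hR, mul_assoc, integral_const_mul]
  rw [k1, k2, finrank_euclideanSpace_fin, abs_of_nonneg (by positivity), smul_eq_mul, smul_eq_mul,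
    mul_div_mul_left _ _ (by positivity), mul_div_mul_left _ _ (by positivity)]

/-! ### Wave packets and their high-frequency limit. -/

/-- Modulation by a cosine splits the Fourier transform into two translates. -/
theorem fourier_cos_mul (f : 𝓢(EuclideanSpace ℝ (Fin d), ℂ)) (v η : EuclideanSpace ℝ (Fin d)) :
    𝓕 (fun x => (Real.cos (2 * Real.pi * ⟪v, x⟫) : ℂ) * f x) η =
      2⁻¹ * (𝓕 f (η - v) + 𝓕 f (η + v)) := by
  have hi : ∀ w : EuclideanSpace ℝ (Fin d), Integrable (fun x : EuclideanSpace ℝ (Fin d) =>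
      Complex.exp (((-2 * Real.pi * ⟪x, w⟫ : ℝ) : ℂ) * Complex.I) • f x) := fun w => by
    refine f.integrable.norm.mono' (Continuous.aestronglyMeasurable ?_) (ae_of_all _ fun x => ?_)
    · have := f.continuous
      fun_prop
    · rw [norm_smul, Complex.norm_exp_ofReal_mul_I, one_mul]
  rw [SchwartzMap.fourier_coe, Real.fourier_eq', Real.fourier_eq', Real.fourier_eq',
    ← integral_add (hi _) (hi _), ← integral_const_mul]
  congr 1
  ext x
  rw [inner_sub_right, inner_add_right, real_inner_comm x v, Complex.ofReal_cos, Complex.cos]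
  simp only [smul_eq_mul]
  have e1 : Complex.exp (((-2 * Real.pi * (⟪x, η⟫ - ⟪x, v⟫) : ℝ) : ℂ) * Complex.I) =
      Complex.exp (((-2 * Real.pi * ⟪x, η⟫ : ℝ) : ℂ) * Complex.I) *
        Complex.exp (((2 * Real.pi * ⟪x, v⟫ : ℝ) : ℂ) * Complex.I) := by
    rw [← Complex.exp_add]
    congr 1
    push_cast
    ring
  have e2 : Complex.exp (((-2 * Real.pi * (⟪x, η⟫ + ⟪x, v⟫) : ℝ) : ℂ) * Complex.I) =
      Complex.exp (((-2 * Real.pi * ⟪x, η⟫ : ℝ) : ℂ) * Complex.I) *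
        Complex.exp (-((2 * Real.pi * ⟪x, v⟫ : ℝ) : ℂ) * Complex.I) := by
    rw [← Complex.exp_add]
    congr 1
    push_cast
    ring
  rw [e1, e2]
  ring

/-- The wave packet `flatCos (2π v·x) ψ(x)`. -/
noncomputable def wavePacket (ψ : 𝓢(EuclideanSpace ℝ (Fin d), ℝ)) (v : EuclideanSpace ℝ (Fin d)) :
    𝓢(EuclideanSpace ℝ (Fin d), ℝ) :=
  SchwartzMap.smulLeftCLM ℝ (fun x => flatCos (2 * Real.pi * ⟪v, x⟫)) ψ

theorem wavePacket_apply (ψ : 𝓢(EuclideanSpace ℝ (Fin d), ℝ)) (v x : EuclideanSpace ℝ (Fin d)) :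
    wavePacket ψ v x = flatCos (2 * Real.pi * ⟪v, x⟫) * ψ x := by
  have h : Function.HasTemperateGrowth
      (fun x : EuclideanSpace ℝ (Fin d) => flatCos (2 * Real.pi * ⟪v, x⟫)) :=
    hasTemperateGrowth_flatCos.comp ((Function.HasTemperateGrowth.const (2 * Real.pi)).mul
      (Function.hasTemperateGrowth_inner_right v))
  rw [wavePacket, SchwartzMap.smulLeftCLM_apply_apply h, smul_eq_mul]

theorem fourier_wavePacket (ψ : 𝓢(EuclideanSpace ℝ (Fin d), ℝ)) (v η : EuclideanSpace ℝ (Fin d)) :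
    𝓕 (fun x => (wavePacket ψ v x : ℂ)) η =
      9 / 16 * (𝓕 (schwartzOfReal ψ) (η - v) + 𝓕 (schwartzOfReal ψ) (η + v)) -
      1 / 16 * (𝓕 (schwartzOfReal ψ) (η - (3 : ℝ) • v) +
        𝓕 (schwartzOfReal ψ) (η + (3 : ℝ) • v)) := by
  have hi : ∀ w : EuclideanSpace ℝ (Fin d), Integrable (fun x : EuclideanSpace ℝ (Fin d) =>
      Complex.exp (((-2 * Real.pi * ⟪x, η⟫ : ℝ) : ℂ) * Complex.I) •
        ((Real.cos (2 * Real.pi * ⟪w, x⟫) : ℂ) * schwartzOfReal ψ x)) := fun w => by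
    refine (schwartzOfReal ψ).integrable.norm.mono' (Continuous.aestronglyMeasurable ?_)
      (ae_of_all _ fun x => ?_)
    · have := (schwartzOfReal ψ).continuous
      fun_prop
    · rw [norm_smul, Complex.norm_exp_ofReal_mul_I, one_mul, norm_mul, Complex.norm_real]
      exact mul_le_of_le_one_left (norm_nonneg _) (Real.abs_cos_le_one _)
  have h1 := fourier_cos_mul (schwartzOfReal ψ) v η
  have h3 := fourier_cos_mul (schwartzOfReal ψ) ((3 : ℝ) • v) η
  rw [Real.fourier_eq'] at h1 h3
  have e : 𝓕 (fun x => (wavePacket ψ v x : ℂ)) η = 9 / 8 * (2⁻¹ *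
      (𝓕 (schwartzOfReal ψ) (η - v) + 𝓕 (schwartzOfReal ψ) (η + v))) - 1 / 8 * (2⁻¹ *
      (𝓕 (schwartzOfReal ψ) (η - (3 : ℝ) • v) + 𝓕 (schwartzOfReal ψ) (η + (3 : ℝ) • v))) := by
    rw [← h1, ← h3, Real.fourier_eq', ← integral_const_mul, ← integral_const_mul,
      ← integral_sub ((hi _).const_mul _) ((hi _).const_mul _)]
    congr 1
    ext x
    have hψ : schwartzOfReal ψ x = (ψ x : ℂ) := rfl
    rw [wavePacket_apply, flatCos, hψ, real_inner_smul_left,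
      show 3 * (2 * Real.pi * ⟪v, x⟫) = 2 * Real.pi * (3 * ⟪v, x⟫) by ring]
    simp only [smul_eq_mul]
    push_cast
    ring
  rw [e]
  ring

/-- The mass of the multiplier `|ξ|^s` against a translate of a Schwartz function. -/
theorem integral_multiplier_translate {s : ℝ} (g : 𝓢(EuclideanSpace ℝ (Fin d), ℂ))
    (v : EuclideanSpace ℝ (Fin d)) :
    ∫ η : EuclideanSpace ℝ (Fin d), ((‖(2 * Real.pi) • η‖ ^ s : ℝ) : ℂ) * g (η - v) =
      ∫ η : EuclideanSpace ℝ (Fin d), ((‖(2 * Real.pi) • (η + v)‖ ^ s : ℝ) : ℂ) * g η := by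
  rw [← integral_add_right_eq_self _ v]
  simp

theorem integrable_multiplier_translate {s : ℝ} (hs : 0 ≤ s)
    (g : 𝓢(EuclideanSpace ℝ (Fin d), ℂ)) (v : EuclideanSpace ℝ (Fin d)) :
    Integrable (fun η : EuclideanSpace ℝ (Fin d) =>
      ((‖(2 * Real.pi) • η‖ ^ s : ℝ) : ℂ) * g (η - v)) := by
  have h := integrable_multiplier_mul hs
    (SchwartzMap.compSubConstCLM ℝ v g)
  exact h

/-- After translation and division by `R^s` the multiplier becomes `‖2π (R⁻¹ η + w)‖^s`, which
converges pointwise to its value at `w`; dominated convergence applies because `g` decays rapidly.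
-/
theorem tendsto_integral_multiplier_translate {s : ℝ} (hs : 0 ≤ s)
    (g : 𝓢(EuclideanSpace ℝ (Fin d), ℂ)) (w : EuclideanSpace ℝ (Fin d)) :
    Tendsto (fun R : ℝ => (((R ^ s)⁻¹ : ℝ) : ℂ) * ∫ η : EuclideanSpace ℝ (Fin d),
      ((‖(2 * Real.pi) • η‖ ^ s : ℝ) : ℂ) * g (η - R • w)) atTop
      (nhds (((‖(2 * Real.pi) • w‖ ^ s : ℝ) : ℂ) * ∫ η, g η)) := by
  rw [← integral_const_mul]
  have hlim : Tendsto (fun R : ℝ => ∫ η : EuclideanSpace ℝ (Fin d),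
      ((‖(2 * Real.pi) • (R⁻¹ • η + w)‖ ^ s : ℝ) : ℂ) * g η) atTop
      (nhds (∫ η, ((‖(2 * Real.pi) • w‖ ^ s : ℝ) : ℂ) * g η)) := by
    have hcont : ∀ R : ℝ, Continuous fun η : EuclideanSpace ℝ (Fin d) =>
        ‖(2 * Real.pi) • (R⁻¹ • η + w)‖ ^ s := fun R =>
      (by fun_prop : Continuous fun η : EuclideanSpace ℝ (Fin d) =>
        ‖(2 * Real.pi) • (R⁻¹ • η + w)‖).rpow_const fun x => Or.inr hs
    refine tendsto_integral_filter_of_dominated_convergence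
      (fun η => (2 * Real.pi * (1 + ‖w‖)) ^ s * ‖(((1 + ‖η‖) ^ s : ℝ) : ℂ) * g η‖) ?_ ?_ ?_ ?_
    · exact Eventually.of_forall fun R =>
        ((Complex.continuous_ofReal.comp (hcont R)).mul g.continuous).aestronglyMeasurable
    · filter_upwards [eventually_ge_atTop 1] with R hR
      refine ae_of_all _ fun η => ?_
      rw [norm_mul, norm_mul, Complex.norm_real, Complex.norm_real,
        Real.norm_of_nonneg (by positivity), Real.norm_of_nonneg (by positivity), ← mul_assoc,
        ← Real.mul_rpow (by positivity) (by positivity)]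
      gcongr
      have h1 : ‖R⁻¹ • η‖ ≤ ‖η‖ := by
        rw [norm_smul, norm_inv, Real.norm_of_nonneg (by linarith)]
        exact mul_le_of_le_one_left (norm_nonneg _) (inv_le_one_of_one_le₀ hR)
      have h2 : ‖R⁻¹ • η + w‖ ≤ (1 + ‖w‖) * (1 + ‖η‖) := by
        nlinarith [norm_add_le (R⁻¹ • η) w, norm_nonneg η, norm_nonneg w]
      rw [norm_smul, Real.norm_of_nonneg (by positivity), mul_assoc (2 * Real.pi) (1 + ‖w‖)]
      exact mul_le_mul_of_nonneg_left h2 (by positivity)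
    · exact (integrable_norm_rpow_mul hs g).norm.const_mul _
    · refine ae_of_all _ fun η => ?_
      have h1 : Tendsto (fun R : ℝ => ‖(2 * Real.pi) • (R⁻¹ • η + w)‖) atTop
          (nhds ‖(2 * Real.pi) • ((0 : ℝ) • η + w)‖) :=
        (((tendsto_inv_atTop_zero.smul_const η).add_const w).const_smul _).norm
      rw [zero_smul, zero_add] at h1
      exact ((Complex.continuous_ofReal.tendsto _).comp
        (h1.rpow_const (Or.inr hs))).mul_const _
  refine hlim.congr' ?_
  filter_upwards [eventually_gt_atTop 0] with R hR
  rw [integral_multiplier_translate, ← integral_const_mul]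
  congr 1
  ext η
  have h1 : (2 * Real.pi) • (η + R • w) = R • ((2 * Real.pi) • (R⁻¹ • η + w)) := by
    rw [smul_comm R, smul_add R, smul_inv_smul₀ hR.ne']
  have h2 : R ^ s ≠ 0 := (Real.rpow_pos_of_pos hR s).ne'
  rw [h1, norm_smul R, Real.norm_of_nonneg hR.le, Real.mul_rpow hR.le (norm_nonneg _),
    ← mul_assoc, ← Complex.ofReal_mul, inv_mul_cancel_left₀ h2]

/-- Fourier inversion at the origin. -/
theorem integral_fourier_schwartzOfReal (ψ : 𝓢(EuclideanSpace ℝ (Fin d), ℝ)) :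
    ∫ η, 𝓕 (schwartzOfReal ψ) η = (ψ 0 : ℂ) := by
  have h : 𝓕⁻ (𝓕 (schwartzOfReal ψ)) 0 = schwartzOfReal ψ 0 := by
    rw [FourierTransform.fourierInv_fourier_eq]
  rw [SchwartzMap.fourierInv_coe, Real.fourierInv_eq'] at h
  simp only [inner_zero_right, mul_zero, Complex.ofReal_zero, zero_mul, Complex.exp_zero,
    one_smul] at h
  exact h

/-- The shifts by `+v` and `+3v` are written as `- -v` and `- -(3v)`, so that one limit statement
covers all four spectral bumps. -/
theorem fracLaplacianC_wavePacket_zero {s : ℝ} (hs : 0 ≤ s)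
    (ψ : 𝓢(EuclideanSpace ℝ (Fin d), ℝ)) (v : EuclideanSpace ℝ (Fin d)) :
    fracLaplacianC s (wavePacket ψ v) 0 =
      9 / 16 * ((∫ η : EuclideanSpace ℝ (Fin d),
        ((‖(2 * Real.pi) • η‖ ^ s : ℝ) : ℂ) * 𝓕 (schwartzOfReal ψ) (η - v)) +
        ∫ η : EuclideanSpace ℝ (Fin d),
        ((‖(2 * Real.pi) • η‖ ^ s : ℝ) : ℂ) * 𝓕 (schwartzOfReal ψ) (η - -v)) -
      1 / 16 * ((∫ η : EuclideanSpace ℝ (Fin d),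
        ((‖(2 * Real.pi) • η‖ ^ s : ℝ) : ℂ) * 𝓕 (schwartzOfReal ψ) (η - (3 : ℝ) • v)) +
        ∫ η : EuclideanSpace ℝ (Fin d),
        ((‖(2 * Real.pi) • η‖ ^ s : ℝ) : ℂ) * 𝓕 (schwartzOfReal ψ) (η - -((3 : ℝ) • v))) := by
  have hi := integrable_multiplier_translate hs (𝓕 (schwartzOfReal ψ))
  have hi2 : ∀ v w : EuclideanSpace ℝ (Fin d), Integrable (fun η : EuclideanSpace ℝ (Fin d) =>
      ((‖(2 * Real.pi) • η‖ ^ s : ℝ) : ℂ) * 𝓕 (schwartzOfReal ψ) (η - v) +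
        ((‖(2 * Real.pi) • η‖ ^ s : ℝ) : ℂ) * 𝓕 (schwartzOfReal ψ) (η - w)) :=
    fun v w => (hi v).add (hi w)
  rw [fracLaplacianC_zero, ← integral_add (hi _) (hi _), ← integral_add (hi _) (hi _),
    ← integral_const_mul, ← integral_const_mul,
    ← integral_sub ((hi2 _ _).const_mul _) ((hi2 _ _).const_mul _)]
  congr 1
  ext η
  rw [fourier_wavePacket, sub_neg_eq_add, sub_neg_eq_add]
  ring

/-- At high frequency the fractional Laplacian of a wave packet behaves at the origin like that
of the underlying plane waves. -/
theorem tendsto_fracLaplacian_wavePacket_zero {s : ℝ} (hs : 0 ≤ s)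
    (ψ : 𝓢(EuclideanSpace ℝ (Fin d), ℝ)) {e : EuclideanSpace ℝ (Fin d)} (he : ‖e‖ = 1) :
    Tendsto (fun R : ℝ => (R ^ s)⁻¹ * fracLaplacian s (wavePacket ψ (R • e)) 0) atTop
      (nhds ((2 * Real.pi) ^ s * ((9 - 3 ^ s) / 8) * ψ 0)) := by
  have ht := tendsto_integral_multiplier_translate hs (𝓕 (schwartzOfReal ψ))
  have h := (((ht e).add (ht (-e))).const_mul (9 / 16)).sub
    (((ht ((3 : ℝ) • e)).add (ht (-((3 : ℝ) • e)))).const_mul (1 / 16))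
  have h2 := (Complex.continuous_re.tendsto _).comp h
  have hval : (9 / 16 * (((‖(2 * Real.pi) • e‖ ^ s : ℝ) : ℂ) * (∫ η, 𝓕 (schwartzOfReal ψ) η) +
      ((‖(2 * Real.pi) • -e‖ ^ s : ℝ) : ℂ) * ∫ η, 𝓕 (schwartzOfReal ψ) η) -
      1 / 16 * (((‖(2 * Real.pi) • (3 : ℝ) • e‖ ^ s : ℝ) : ℂ) *
        (∫ η, 𝓕 (schwartzOfReal ψ) η) +
      ((‖(2 * Real.pi) • -((3 : ℝ) • e)‖ ^ s : ℝ) : ℂ) * ∫ η, 𝓕 (schwartzOfReal ψ) η)) =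
      (((2 * Real.pi) ^ s * ((9 - 3 ^ s) / 8) * ψ 0 : ℝ) : ℂ) := by
    rw [integral_fourier_schwartzOfReal, smul_neg, smul_neg, norm_neg, norm_neg, norm_smul,
      norm_smul, norm_smul, he, Real.norm_of_nonneg (by positivity : 0 ≤ 2 * Real.pi),
      Real.norm_of_nonneg (by norm_num : (0 : ℝ) ≤ 3), mul_one, mul_one,
      Real.mul_rpow (by positivity) (by norm_num : (0 : ℝ) ≤ 3)]
    push_cast
    ring
  rw [hval, Complex.ofReal_re] at h2
  refine h2.congr fun R => ?_
  simp only [Function.comp_apply]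
  rw [fracLaplacian, fracLaplacianC_wavePacket_zero hs, ← Complex.re_ofReal_mul]
  congr 1
  rw [smul_neg, smul_neg, smul_comm (3 : ℝ) R e]
  ring

theorem abs_wavePacket_le (ψ : 𝓢(EuclideanSpace ℝ (Fin d), ℝ))
    (v x : EuclideanSpace ℝ (Fin d)) : |wavePacket ψ v x| ≤ |ψ x| := by
  rw [wavePacket_apply, abs_mul]
  exact mul_le_of_le_one_left (abs_nonneg _) (abs_flatCos_le_one _)

theorem wavePacket_zero (ψ : 𝓢(EuclideanSpace ℝ (Fin d), ℝ)) (v : EuclideanSpace ℝ (Fin d)) :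
    wavePacket ψ v 0 = ψ 0 := by
  rw [wavePacket_apply, inner_zero_right, mul_zero, flatCos_zero, one_mul]

/-- Wave packets of high frequency violate the generalized Bernstein inequality of order `s > 2`
for all large exponents. -/
theorem eventually_exists_forall_integral_wavePacket_neg {s : ℝ} (hs : 2 < s)
    {ψ : 𝓢(EuclideanSpace ℝ (Fin d), ℝ)} (h0 : ψ 0 = 1) (h1 : ∀ x, x ≠ 0 → |ψ x| < 1)
    {e : EuclideanSpace ℝ (Fin d)} (he : ‖e‖ = 1) :
    ∀ᶠ R : ℝ in atTop, ∃ p₀ : ℝ, 2 < p₀ ∧ ∀ p, p₀ ≤ p →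
      ∫ x, fracLaplacian s (wavePacket ψ (R • e)) x *
        (|wavePacket ψ (R • e) x| ^ (p - 2) * wavePacket ψ (R • e) x) < 0 := by
  have hs0 : 0 ≤ s := by linarith
  have h9 : (9 : ℝ) < 3 ^ s := by
    have h := Real.rpow_lt_rpow_of_exponent_lt (by norm_num : (1 : ℝ) < 3) hs
    rw [Real.rpow_two] at h
    linarith
  have hneg : (2 * Real.pi) ^ s * ((9 - 3 ^ s) / 8) * ψ 0 < 0 := by
    rw [h0, mul_one]
    exact mul_neg_of_pos_of_neg (by positivity) (by linarith)
  filter_upwards [(tendsto_fracLaplacian_wavePacket_zero hs0 ψ he).eventually_lt_const hneg,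
    eventually_gt_atTop 0] with R hR hR0
  have hG0 : fracLaplacian s (wavePacket ψ (R • e)) 0 < 0 := by
    have : 0 < (R ^ s)⁻¹ := by positivity
    exact (pos_iff_neg_of_mul_neg hR).mp this
  exact exists_forall_integral_mul_abs_rpow_mul_neg volume (continuous_fracLaplacian hs0 _)
    (abs_fracLaplacian_le s _) hG0 (SchwartzMap.continuous _) (SchwartzMap.integrable _)
    (by rw [wavePacket_zero, h0]) (fun x hx => (abs_wavePacket_le ψ _ x).trans_lt (h1 x hx))
    (SchwartzMap.tendsto_cocompact _)

/-! ### The two envelopes. -/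

/-- A smooth compactly supported function with a strict maximum at the origin. -/
theorem exists_schwartz_hasCompactSupport_strict_max :
    ∃ ψ : 𝓢(EuclideanSpace ℝ (Fin d), ℝ), HasCompactSupport ψ ∧ ψ 0 = 1 ∧
      ∀ x, x ≠ 0 → |ψ x| < 1 := by
  let b : ContDiffBump (0 : EuclideanSpace ℝ (Fin d)) := ⟨1, 2, by norm_num, by norm_num⟩
  have hc : HasCompactSupport fun x : EuclideanSpace ℝ (Fin d) => b x * Real.exp (-‖x‖ ^ 2) :=
    b.hasCompactSupport.mul_right
  have hd : ContDiff ℝ ∞ fun x : EuclideanSpace ℝ (Fin d) => b x * Real.exp (-‖x‖ ^ 2) :=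
    b.contDiff.mul (Real.contDiff_exp.comp (contDiff_norm_sq ℝ).neg)
  refine ⟨hc.toSchwartzMap hd, hc, ?_, fun x hx => ?_⟩
  · change b 0 * Real.exp (-‖(0 : EuclideanSpace ℝ (Fin d))‖ ^ 2) = 1
    rw [b.one_of_mem_closedBall (Metric.mem_closedBall_self b.rIn_pos.le)]
    simp
  · change |b x * Real.exp (-‖x‖ ^ 2)| < 1
    rw [abs_of_nonneg (mul_nonneg b.nonneg (Real.exp_pos _).le)]
    have hx' : 0 < ‖x‖ := norm_pos_iff.mpr hx
    refine (mul_le_of_le_one_left (Real.exp_pos _).le b.le_one).trans_lt ?_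
    rw [Real.exp_lt_one_iff]
    have : 0 < ‖x‖ ^ 2 := by positivity
    linarith

/-- The Fourier transform of a real even Schwartz function is the cosine transform. -/
theorem fourier_schwartzOfReal_of_even {ρ : 𝓢(EuclideanSpace ℝ (Fin d), ℝ)}
    (hρ : ∀ x, ρ (-x) = ρ x) (x : EuclideanSpace ℝ (Fin d)) :
    𝓕 (schwartzOfReal ρ) x = ((∫ ξ, Real.cos (2 * Real.pi * ⟪ξ, x⟫) * ρ ξ : ℝ) : ℂ) := by
  have hi : ∀ t : ℝ, Integrable (fun ξ : EuclideanSpace ℝ (Fin d) =>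
      Complex.exp (((t * Real.pi * ⟪ξ, x⟫ : ℝ) : ℂ) * Complex.I) • schwartzOfReal ρ ξ) :=
    fun t => by
    refine (schwartzOfReal ρ).integrable.norm.mono' (Continuous.aestronglyMeasurable ?_)
      (ae_of_all _ fun x => ?_)
    · have := (schwartzOfReal ρ).continuous
      fun_prop
    · rw [norm_smul, Complex.norm_exp_ofReal_mul_I, one_mul]
  have h1 : 𝓕 (schwartzOfReal ρ) x = ∫ ξ : EuclideanSpace ℝ (Fin d),
      Complex.exp (((-2 * Real.pi * ⟪ξ, x⟫ : ℝ) : ℂ) * Complex.I) • schwartzOfReal ρ ξ := by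
    rw [SchwartzMap.fourier_coe, Real.fourier_eq']
  have h2 : 𝓕 (schwartzOfReal ρ) x = ∫ ξ : EuclideanSpace ℝ (Fin d),
      Complex.exp (((2 * Real.pi * ⟪ξ, x⟫ : ℝ) : ℂ) * Complex.I) • schwartzOfReal ρ ξ := by
    rw [h1, ← integral_neg_eq_self]
    congr 1
    ext ξ
    have h : schwartzOfReal ρ (-ξ) = schwartzOfReal ρ ξ := congrArg Complex.ofReal (hρ ξ)
    rw [h, inner_neg_left]
    congr 4
    ring
  have h3 : 𝓕 (schwartzOfReal ρ) x =
      -- The average of the representations with phases `e^{-iθ}` and `e^{iθ}` turns the kernel into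
      -- a cosine.
      2⁻¹ * (𝓕 (schwartzOfReal ρ) x + 𝓕 (schwartzOfReal ρ) x) := by ring
  rw [h3]
  nth_rw 1 [h1]
  rw [h2, ← integral_add (hi _) (hi _), ← integral_const_mul, ← integral_complex_ofReal]
  congr 1
  ext ξ
  have h : schwartzOfReal ρ ξ = (ρ ξ : ℂ) := rfl
  rw [h, Complex.ofReal_mul (Real.cos _), Complex.ofReal_cos, Complex.cos]
  have e1 : ((-2 * Real.pi * ⟪ξ, x⟫ : ℝ) : ℂ) = -((2 * Real.pi * ⟪ξ, x⟫ : ℝ) : ℂ) := by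
    push_cast
    ring
  rw [e1]
  simp only [smul_eq_mul]
  ring

/-- Both `ρ + cos · ρ` and `ρ - cos · ρ` are nonnegative and continuous, so one point of strict
positivity for each suffices: the origin for the first, a small multiple of `x` for the second. -/
theorem abs_integral_cos_mul_lt {ρ : EuclideanSpace ℝ (Fin d) → ℝ} (hρ : Continuous ρ)
    (hc : HasCompactSupport ρ) (hn : ∀ ξ, 0 ≤ ρ ξ) {r : ℝ} (hr : 0 < r)
    (hpos : ∀ ξ, ‖ξ‖ < r → 0 < ρ ξ) {x : EuclideanSpace ℝ (Fin d)} (hx : x ≠ 0) :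
    |∫ ξ, Real.cos (2 * Real.pi * ⟪ξ, x⟫) * ρ ξ| < ∫ ξ, ρ ξ := by
  have hcos : Continuous fun ξ : EuclideanSpace ℝ (Fin d) =>
      Real.cos (2 * Real.pi * ⟪ξ, x⟫) * ρ ξ := by fun_prop
  have hi : Integrable fun ξ : EuclideanSpace ℝ (Fin d) =>
      Real.cos (2 * Real.pi * ⟪ξ, x⟫) * ρ ξ :=
    hcos.integrable_of_hasCompactSupport hc.mul_left
  have hi' : Integrable ρ := hρ.integrable_of_hasCompactSupport hc
  have hx' : 0 < ‖x‖ := norm_pos_iff.mpr hx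
  rw [abs_lt]
  constructor
  · have h : 0 < ∫ ξ, (ρ ξ + Real.cos (2 * Real.pi * ⟪ξ, x⟫) * ρ ξ) := by
      refine integral_pos_of_integrable_nonneg_nonzero (x := 0) (by fun_prop) (hi'.add hi)
        (fun ξ => ?_) ?_
      · have := mul_nonneg (by linarith [Real.neg_one_le_cos (2 * Real.pi * ⟪ξ, x⟫)] :
          0 ≤ 1 + Real.cos (2 * Real.pi * ⟪ξ, x⟫)) (hn ξ)
        change 0 ≤ ρ ξ + Real.cos (2 * Real.pi * ⟪ξ, x⟫) * ρ ξ
        linarith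
      · have := hpos 0 (by simpa using hr)
        rw [inner_zero_left, mul_zero, Real.cos_zero]
        linarith
    rw [integral_add hi' hi] at h
    linarith
  -- The first bound keeps `t • x` where `ρ > 0`; the second keeps the phase `2π t ‖x‖^2` in `(0,
  -- π)`, where the cosine is below `1`.
  · obtain ⟨t, ht0, ht⟩ := exists_between
      (show (0 : ℝ) < min (r / ‖x‖) ((2 * ‖x‖ ^ 2)⁻¹) from lt_min (by positivity) (by positivity))
    have ht1 : t * ‖x‖ < r := (lt_div_iff₀ hx').mp (ht.trans_le (min_le_left _ _))
    have ht2 : t * (2 * ‖x‖ ^ 2) < 1 := by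
      have := ht.trans_le (min_le_right _ _)
      rwa [← one_div, lt_div_iff₀ (by positivity)] at this
    have h : 0 < ∫ ξ, (ρ ξ - Real.cos (2 * Real.pi * ⟪ξ, x⟫) * ρ ξ) := by
      refine integral_pos_of_integrable_nonneg_nonzero (x := t • x) (by fun_prop) (hi'.sub hi)
        (fun ξ => ?_) ?_
      · have := mul_nonneg (by linarith [Real.cos_le_one (2 * Real.pi * ⟪ξ, x⟫)] :
          0 ≤ 1 - Real.cos (2 * Real.pi * ⟪ξ, x⟫)) (hn ξ)
        change 0 ≤ ρ ξ - Real.cos (2 * Real.pi * ⟪ξ, x⟫) * ρ ξ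
        linarith
      · have h1 := hpos (t • x) (by rwa [norm_smul, Real.norm_of_nonneg ht0.le])
        have h2 : Real.cos (2 * Real.pi * ⟪t • x, x⟫) < Real.cos 0 := by
          rw [real_inner_smul_left, real_inner_self_eq_norm_sq]
          refine Real.cos_lt_cos_of_nonneg_of_le_pi le_rfl ?_ (by positivity)
          nlinarith [Real.pi_pos]
        rw [Real.cos_zero] at h2
        nlinarith
    rw [integral_sub hi' hi] at h
    linarith

/-- A real Schwartz function with compactly supported Fourier transform and a strict maximum at
the origin. -/
theorem exists_schwartz_fourier_support_strict_max :
    ∃ ψ : 𝓢(EuclideanSpace ℝ (Fin d), ℝ),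
      (∀ η, 1 < ‖η‖ → 𝓕 (schwartzOfReal ψ) η = 0) ∧ ψ 0 = 1 ∧ ∀ x, x ≠ 0 → |ψ x| < 1 := by
  let b : ContDiffBump (0 : EuclideanSpace ℝ (Fin d)) := ⟨1 / 2, 1, by norm_num, by norm_num⟩
  let ρ : 𝓢(EuclideanSpace ℝ (Fin d), ℝ) := b.hasCompactSupport.toSchwartzMap b.contDiff
  have hρ : ∀ x, ρ x = b x := fun x => rfl
  have heven : ∀ x, ρ (-x) = ρ x := fun x => b.neg x
  set M : ℝ := ∫ ξ, b ξ with hM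
  have hM0 : 0 < M := b.integral_pos
  have hΦ := fourier_schwartzOfReal_of_even heven
  -- The Fourier transform of an even bump is real, so taking the real part loses nothing; dividing
  -- by the mass `M` normalises the value at `0`.
  let ψ : 𝓢(EuclideanSpace ℝ (Fin d), ℝ) :=
    M⁻¹ • (𝓕 (schwartzOfReal ρ)).postcompCLM Complex.reCLM
  have hψ : ∀ x, ψ x = M⁻¹ * ∫ ξ, Real.cos (2 * Real.pi * ⟪ξ, x⟫) * b ξ := fun x => by
    change M⁻¹ * (𝓕 (schwartzOfReal ρ) x).re = _
    rw [hΦ, Complex.ofReal_re]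
    rfl
  have hψC : schwartzOfReal ψ = (M⁻¹ : ℂ) • 𝓕 (schwartzOfReal ρ) := by
    ext x
    change ((M⁻¹ * (𝓕 (schwartzOfReal ρ) x).re : ℝ) : ℂ) = (M⁻¹ : ℂ) * 𝓕 (schwartzOfReal ρ) x
    rw [hΦ, Complex.ofReal_re]
    push_cast
    rfl
  refine ⟨ψ, fun η hη => ?_, ?_, fun x hx => ?_⟩
  · have h1 : 𝓕 (𝓕 (schwartzOfReal ρ)) η = schwartzOfReal ρ (-η) := by
      have h2 : 𝓕⁻ (𝓕 (schwartzOfReal ρ)) (-η) = schwartzOfReal ρ (-η) := by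
        rw [FourierTransform.fourierInv_fourier_eq]
      rw [← h2, SchwartzMap.fourierInv_coe, Real.fourierInv_eq_fourier_neg, neg_neg,
        SchwartzMap.fourier_coe (𝓕 (schwartzOfReal ρ))]
    have h3 : schwartzOfReal ρ (-η) = 0 := by
      change ((b (-η) : ℝ) : ℂ) = 0
      rw [b.zero_of_le_dist (by simpa using hη.le), Complex.ofReal_zero]
    rw [hψC, FourierTransform.fourier_smul, smul_apply, h1, h3, smul_zero]
  · rw [hψ]
    simp only [inner_zero_right, mul_zero, Real.cos_zero, one_mul]
    exact inv_mul_cancel₀ hM0.ne'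
  · rw [hψ, abs_mul, abs_of_pos (inv_pos.mpr hM0), inv_mul_lt_iff₀ hM0, mul_one]
    exact abs_integral_cos_mul_lt b.continuous b.hasCompactSupport (fun _ => b.nonneg)
      (by norm_num : (0 : ℝ) < 1) (fun ξ hξ => b.pos_of_mem_ball (by simpa using hξ)) hx

/-! ### Spectral localisation of packets and their dilates. -/

/-- The spectrum lies in the unit balls around `±v` and `±3v`. -/
theorem fourier_wavePacket_support {ψ : 𝓢(EuclideanSpace ℝ (Fin d), ℝ)}
    (hψ : ∀ η, 1 < ‖η‖ → 𝓕 (schwartzOfReal ψ) η = 0) {v η : EuclideanSpace ℝ (Fin d)}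
    (hη : 𝓕 (fun x => (wavePacket ψ v x : ℂ)) η ≠ 0) :
    ‖v‖ - 1 ≤ ‖η‖ ∧ ‖η‖ ≤ 3 * ‖v‖ + 1 := by
  have hnorm : ‖(3 : ℝ) • v‖ = 3 * ‖v‖ := by
    rw [norm_smul, Real.norm_of_nonneg (by norm_num)]
  by_contra hcon
  refine hη ?_
  have hv := norm_nonneg v
  have key : ∀ w : EuclideanSpace ℝ (Fin d), ‖v‖ ≤ ‖w‖ → ‖w‖ ≤ 3 * ‖v‖ → 1 < ‖η - w‖ := by
    intro w h1 h3
    by_contra hle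
    rw [not_lt] at hle
    have := norm_sub_norm_le w η
    rw [norm_sub_rev] at this
    have := norm_sub_norm_le η w
    exact hcon ⟨by linarith, by linarith⟩
  have k1 := key v le_rfl (by linarith)
  have k2 := key (-v) (by rw [norm_neg]) (by rw [norm_neg]; linarith)
  have k3 := key ((3 : ℝ) • v) (by linarith) hnorm.le
  have k4 := key (-((3 : ℝ) • v)) (by rw [norm_neg]; linarith) (by rw [norm_neg]; exact hnorm.le)
  rw [sub_neg_eq_add] at k2 k4
  rw [fourier_wavePacket, hψ _ k1, hψ _ k2, hψ _ k3, hψ _ k4]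
  ring

/-- Dilation of a Schwartz function by a nonzero factor. -/
noncomputable def schwartzDilate (R : ℝ) (hR : R ≠ 0) (f : 𝓢(EuclideanSpace ℝ (Fin d), ℝ)) :
    𝓢(EuclideanSpace ℝ (Fin d), ℝ) :=
  SchwartzMap.compCLMOfContinuousLinearEquiv ℝ
    (LinearEquiv.smulOfNeZero ℝ (EuclideanSpace ℝ (Fin d)) R hR).toContinuousLinearEquiv f

/-- Non-strict inequalities make the annulus closed, so it contains the closure of the set where the
transform is nonzero. The factor `2π` converts to angular frequency. -/
theorem tsupport_angularFourier_schwartzDilate_subset {ψ : 𝓢(EuclideanSpace ℝ (Fin d), ℝ)}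
    (hψ : ∀ η, 1 < ‖η‖ → 𝓕 (schwartzOfReal ψ) η = 0) (v : EuclideanSpace ℝ (Fin d))
    {R : ℝ} (hR : 0 < R) :
    tsupport (angularFourier (schwartzDilate R hR.ne' (wavePacket ψ v))) ⊆
      {ξ | 2 * Real.pi * (‖v‖ - 1) * R ≤ ‖ξ‖ ∧ ‖ξ‖ ≤ 2 * Real.pi * (3 * ‖v‖ + 1) * R} := by
  refine closure_minimal (fun ξ hξ => ?_) ((isClosed_le continuous_const continuous_norm).inter
    (isClosed_le continuous_norm continuous_const))
  have hξ' : 𝓕 (fun x => (wavePacket ψ v (R • x) : ℂ)) ((2 * Real.pi)⁻¹ • ξ) ≠ 0 := hξ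
  rw [fourier_comp_smul (fun x => (wavePacket ψ v x : ℂ)) hR] at hξ'
  obtain ⟨h1, h2⟩ := fourier_wavePacket_support hψ (right_ne_zero_of_mul hξ')
  have hn : ‖R⁻¹ • (2 * Real.pi)⁻¹ • ξ‖ = ‖ξ‖ / (2 * Real.pi * R) := by
    rw [norm_smul, norm_smul, norm_inv, norm_inv, Real.norm_of_nonneg hR.le,
      Real.norm_of_nonneg (by positivity)]
    field_simp
  rw [hn, le_div_iff₀ (by positivity)] at h1
  rw [hn, div_le_iff₀ (by positivity)] at h2
  constructor <;> linarith

/-! ### Assembly. -/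

theorem theorem3p2 (d : ℕ) (hd : 1 ≤ d) (s : ℝ) (hs : 2 < s) :
    ∃ p₀ : ℝ, 2 < p₀ ∧ ∀ p : ℝ, p₀ ≤ p →
      (∃ C : ℝ, 0 < C ∧ ∃ f : EuclideanSpace ℝ (Fin d) → ℝ,
        ContDiff ℝ ∞ f ∧ HasCompactSupport f ∧
        (∫ x, fracLaplacian s f x * (|f x| ^ (p - 2) * f x)) ≤ -C) ∧
      (∃ D₁ D₂ α₁ α₂ : ℝ, 0 < D₁ ∧ 0 < D₂ ∧ 0 < α₁ ∧ 0 < α₂ ∧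
        ∃ (N : ℕ → ℝ) (f : ℕ → 𝓢(EuclideanSpace ℝ (Fin d), ℝ)),
          Tendsto N atTop atTop ∧ ∀ j : ℕ, 0 < N j ∧
            tsupport (angularFourier (f j)) ⊆ {ξ | α₁ * N j < ‖ξ‖ ∧ ‖ξ‖ < α₂ * N j} ∧
            -D₂ < (∫ x, fracLaplacian s (f j) x * (|f j x| ^ (p - 2) * f j x)) /
              (N j ^ s * ∫ x, |f j x| ^ p) ∧
            (∫ x, fracLaplacian s (f j) x * (|f j x| ^ (p - 2) * f j x)) /
              (N j ^ s * ∫ x, |f j x| ^ p) < -D₁) := by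
  obtain ⟨e, he⟩ : ∃ e : EuclideanSpace ℝ (Fin d), ‖e‖ = 1 :=
    ⟨EuclideanSpace.single ⟨0, hd⟩ 1, by simp⟩
  obtain ⟨χ, hχc, hχ0, hχ1⟩ := exists_schwartz_hasCompactSupport_strict_max (d := d)
  obtain ⟨ψ, hψs, hψ0, hψ1⟩ := exists_schwartz_fourier_support_strict_max (d := d)
  obtain ⟨R, p₁, hp₁, hR⟩ :=
    (eventually_exists_forall_integral_wavePacket_neg hs hχ0 hχ1 he).exists
  obtain ⟨S, ⟨p₂, hp₂, hS⟩, hS2⟩ :=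
    -- `S ≥ 2` makes the inner radius `S - 1` positive, so the spectrum stays away from the origin.
    ((eventually_exists_forall_integral_wavePacket_neg hs hψ0 hψ1 he).and
      (eventually_ge_atTop 2)).exists
  refine ⟨max p₁ p₂, lt_max_of_lt_left hp₁, fun p hp => ⟨?_, ?_⟩⟩
  · have h := hR p ((le_max_left _ _).trans hp)
    refine ⟨_, neg_pos.mpr h, wavePacket χ (R • e), SchwartzMap.smooth _ ⊤, ?_, (neg_neg _).ge⟩
    refine hχc.mono fun x hx => ?_
    rw [Function.mem_support, wavePacket_apply] at hx
    exact right_ne_zero_of_mul hx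
  · set W := wavePacket ψ (S • e) with hW
    have hp2 : 2 < p := hp₂.trans_le ((le_max_right _ _).trans hp)
    have hnum := hS p ((le_max_right _ _).trans hp)
    have hWc : Continuous W := W.continuous
    have hW0 : W 0 = 1 := by rw [hW, wavePacket_zero, hψ0]
    have hWle : ∀ x, |W x| ≤ 1 := fun x => by
      refine (abs_wavePacket_le ψ _ x).trans ?_
      by_cases hx : x = 0
      · simp [hx, hψ0]
      · exact (hψ1 x hx).le
    have hpc : Continuous fun x => |W x| ^ p := hWc.abs.rpow_const fun x => Or.inr (by linarith)
    have hden : 0 < ∫ x, |W x| ^ p := by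
      refine integral_pos_of_integrable_nonneg_nonzero (x := 0) hpc ?_
        (fun x => Real.rpow_nonneg (abs_nonneg _) _) (by simp [hW0])
      refine W.integrable.norm.mono' hpc.aestronglyMeasurable (ae_of_all _ fun x => ?_)
      rw [Real.norm_of_nonneg (Real.rpow_nonneg (abs_nonneg _) _), Real.norm_eq_abs]
      exact Real.rpow_le_self_of_le_one (abs_nonneg _) (hWle x) (by linarith)
    set q := (∫ x, fracLaplacian s W x * (|W x| ^ (p - 2) * W x)) / ∫ x, |W x| ^ p with hq
    have hq0 : q < 0 := div_neg_of_neg_of_pos hnum hden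
    have hN : ∀ j : ℕ, 0 < (j : ℝ) + 1 := fun j => by positivity
    have hSe : ‖S • e‖ = S := by rw [norm_smul, he, mul_one, Real.norm_of_nonneg (by linarith)]
    have hpi := Real.pi_pos
    -- Every dilate has quotient exactly `q < 0`, so `2q < q < q / 2` gives `D₂` and `D₁`. The
    -- spectrum lies between `2π (S - 1) N` and `2π (3S + 1) N`; halving the inner radius and
    -- enlarging the outer one give strict inequalities. `N j = j + 1` is positive also at `j = 0`.
    refine ⟨-q / 2, -2 * q, Real.pi * (S - 1), 2 * Real.pi * (3 * S + 2), by linarith,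
      by linarith, mul_pos hpi (by linarith), by positivity, fun j => (j : ℝ) + 1,
      fun j => schwartzDilate ((j : ℝ) + 1) (hN j).ne' W,
      tendsto_atTop_add_const_right _ _ tendsto_natCast_atTop_atTop, fun j => ⟨hN j, ?_, ?_⟩⟩
    · refine (tsupport_angularFourier_schwartzDilate_subset hψs _ (hN j)).trans ?_
      rintro ξ ⟨h1, h2⟩
      rw [hSe] at h1 h2
      have h3 : 0 < Real.pi * ((j : ℝ) + 1) := mul_pos hpi (hN j)
      constructor <;> nlinarith
    · have hquot : (∫ x, fracLaplacian s (schwartzDilate ((j : ℝ) + 1) (hN j).ne' W) x *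
          (|schwartzDilate ((j : ℝ) + 1) (hN j).ne' W x| ^ (p - 2) *
            schwartzDilate ((j : ℝ) + 1) (hN j).ne' W x)) /
          (((j : ℝ) + 1) ^ s * ∫ x, |schwartzDilate ((j : ℝ) + 1) (hN j).ne' W x| ^ p) = q :=
        bernsteinQuotient_comp_smul s p W (hN j)
      rw [hquot]
      constructor <;> linarith
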